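/- \textbf{Setting.} There are $m$ arms and a finite nonempty set of actions $\mathcal S$. In each epoch $t=1,2,\dots$ a state vector $X^{(t)}\in\{0,1\}^m$ is drawn, independently of the past, from a joint distribution $D$ with expectation vector $\mu\in[0,1]^m$ (the states of different arms may be correlated). The learner plays an action $S_t\in\mathcal S$. A random set of arms $\tau_t\subseteq\{1,\dots,m\}$, drawn from $D^{\mathrm{trig}}(S_t,X^{(t)})$, is triggered, the states $X^{(t)}_i$, $i\in\tau_t$, are observed, and a reward $R(S_t,X^{(t)},\tau_t)\ge 0$ is collected, where $R$ is deterministic. The expected reward $r_\mu(S)=\mathbb E[R(S,X,\tau)]$ depends on $D$ through its expectation vector: for each $\theta\in[0,1]^m$ there is a joint distribution $D_\theta$ on $\{0,1\}^m$ with expectation vector $\theta$, with $D_\mu=D$, and $r_\theta(S)$ is the expected reward under $D_\theta$; put $r^*_\theta=\max_{S}r_\theta(S)$. Assume: (i) (bounded smoothness) $f:[0,\infty)\to[0,\infty)$ is continuous and strictly increasing with $f(0)=0$, and $|r_\theta(S)-r_{\theta'}(S)|\le f(\Delta)$ for all $S$ whenever $\Delta>0$ and $\max_i|\theta_i-\theta'_i|\le\Delta$;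 (ii) (monotonicity) $r_\theta(S)\le r_{\theta'}(S)$ for all $S$ whenever $\theta_i\le\theta'_i$ for all $i$; (iii) (positive triggering probabilities) $p^*>0$, and when any action $S$ is played each arm is triggered with probability at least $p^*$; (iv) when an action $S$ is played, the event that arm $i$ is triggered is independent of the state of arm $i$, for every $S$ and $i$. Let $\alpha,\beta\in[0,1]$ and let $\mathcal O$ be an $(\alpha,\beta)$-approximation algorithm: a randomized algorithm that on every input $\theta\in[0,1]^m$ returns an action $S^{\mathcal O}$ with $\Pr(r_\theta(S^{\mathcal O})\ge\alpha r^*_\theta)\ge\beta$. Combinatorial Thompson Sampling (CTS) starts with counters $s_i=f_i=0$. In each epoch it samples independently $\nu_i\sim\mathrm{Beta}(s_i+1,f_i+1)$ for every arm $i$, plays the action $S_t$ returned by $\mathcal O$ on input $\nu$ (with fresh randomness), and for each triggered arm $i$ increases $s_i$ by one if $X^{(t)}_i=1$ and $f_i$ by one if $X^{(t)}_i=0$. Its regret is $$\mathrm{Reg}(T)=T\alpha\beta r^*_\mu-\mathbb E\Big[\sum_{t=1}^{T}r_\mu(S_t)\Big].$$ A bad action is an $S$ with $r_\mu(S)<\alpha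 r^*_\mu$; $\nabla_{\max}$ and $\nabla_{\min}$ are the largest and the smallest value of $\alpha r^*_\mu-r_\mu(S)$ over the bad actions $S$ (both are $0$ if there is no bad action, and then the right-hand side below is read as $0$). Assume that $\nabla_{\min}/2$ is in the range of $f$ and put $\delta:=f^{-1}(\nabla_{\min}/2)$. \textbf{Theorem.} For all integers $T\ge1$, $$\mathrm{Reg}(T)\le\nabla_{\max}\inf_{\eta\in(0,1)}\left(\lceil t'\rceil+\frac{(3+e^{2\delta})m\pi^2}{6}\Big(1+\frac{2}{\delta^2}\Big)+(3+e^{2\delta})m\Big(1+\frac{2}{\delta^2\eta p^*}\Big)\right),$$ where $t':=4c^2/e^2$ and $c:=1/(p^*(1-\eta))^2$. -/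

import Mathlib

open MeasureTheory ProbabilityTheory
open scoped NNReal

namespace CMAB

/-- Expectation vectors of `m` arms with states in `{0, 1}`: the elements of `[0, 1]^m`. -/
abbrev MeanVec (m : ℕ) : Type := Fin m → unitInterval

/-- Joint states of `m` Bernoulli arms (`true` is the state `1`, `false` is the state `0`). -/
abbrev States (m : ℕ) : Type := Fin m → Bool

/-- A combinatorial bandit problem with probabilistically triggered Bernoulli arms and action
set `A`. The expected reward of an action is a function of the expectation vector of the arms,
so the joint distribution of the states comes as a family indexed by its expectation vector
(the states of different arms may be correlated). -/
structure Problem (m : ℕ) (A : Type*) where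
  /-- The joint distribution of the arm states, for each expectation vector. -/
  stateLaw : MeanVec m → PMF (States m)
  /-- The state of arm `i` has expectation `θ i` under `stateLaw θ`. -/
  mean_eq : ∀ (θ : MeanVec m) (i : Fin m),
    ∫ x, (if x i = true then (1 : ℝ) else 0) ∂(stateLaw θ).toMeasure = θ i
  /-- The probabilistic triggering function: the distribution of the random set of triggered
  arms, given the action and the states of all the arms. -/
  trig : A → States m → PMF (Finset (Fin m))
  /-- The non-negative reward, a deterministic function of the action, the states and the set of
  triggered arms. -/
  reward : A → States m → Finset (Fin m) → ℝ≥0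

namespace Problem

variable {m : ℕ} {A : Type*} (P : Problem m A)

/-- The joint law of the states and of the set of triggered arms in an epoch in which action `S`
is played. -/
noncomputable def outcome (θ : MeanVec m) (S : A) : Measure (States m × Finset (Fin m)) :=
  ((P.stateLaw θ).bind fun x => (P.trig S x).map fun τ => (x, τ)).toMeasure

/-- The expected reward `r_θ(S)`. -/
noncomputable def r (θ : MeanVec m) (S : A) : ℝ :=
  ∫ z, (P.reward S z.1 z.2 : ℝ) ∂(P.outcome θ S)

/-- The optimal expected reward `r*_θ`. -/
noncomputable def rStar (θ : MeanVec m) : ℝ := ⨆ S, P.r θ S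

/-- `f` is a bounded smoothness function of the expected reward. -/
structure BoundedSmooth (f : ℝ≥0 → ℝ≥0) : Prop where
  continuous : Continuous f
  strictMono : StrictMono f
  zero : f 0 = 0
  bound : ∀ (θ θ' : MeanVec m) (Δ : ℝ≥0), 0 < Δ →
    (∀ i, |(θ i : ℝ) - (θ' i : ℝ)| ≤ (Δ : ℝ)) → ∀ S, |P.r θ S - P.r θ' S| ≤ (f Δ : ℝ)

/-- The expected reward is monotone in the expectation vector. -/
def MonotoneReward : Prop :=
  ∀ θ θ' : MeanVec m, (∀ i, θ i ≤ θ' i) → ∀ S, P.r θ S ≤ P.r θ' S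

/-- The probability that action `S` triggers arm `i`. -/
noncomputable def trigProb (θ : MeanVec m) (S : A) (i : Fin m) : ℝ :=
  (P.outcome θ S).real {z | i ∈ z.2}

/-- When action `S` is played, the event that arm `i` is triggered and the state of arm `i` are
independent (for every `S` and `i`). -/
def OwnStateIndep (θ : MeanVec m) : Prop :=
  ∀ (S : A) (i : Fin m), IndepSet {z : States m × Finset (Fin m) | i ∈ z.2}
    {z : States m × Finset (Fin m) | z.1 i = true} (P.outcome θ S)

/-- The gap `α r*_μ - r_μ(S)` of action `S`. -/
noncomputable def gap (μ : MeanVec m) (α : ℝ) (S : A) : ℝ := α * P.rStar μ - P.r μ S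

/-- The bad actions: those with expected reward smaller than `α r*_μ`. -/
def bad (μ : MeanVec m) (α : ℝ) : Set A := {S | P.r μ S < α * P.rStar μ}

/-- The largest gap of a bad action (`0` if there is no bad action). -/
noncomputable def gapMax (μ : MeanVec m) (α : ℝ) : ℝ := sSup (P.gap μ α '' P.bad μ α)

/-- The smallest gap of a bad action (`0` if there is no bad action). -/
noncomputable def gapMin (μ : MeanVec m) (α : ℝ) : ℝ := sInf (P.gap μ α '' P.bad μ α)

/-- The randomized algorithm `O`, which takes an expectation vector and returns an action, is an
`(α, β)`-approximation algorithm. -/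
def IsApproxOracle [MeasurableSpace A] (O : Kernel (MeanVec m) A) (α β : ℝ) : Prop :=
  IsMarkovKernel O ∧ ∀ θ : MeanVec m, β ≤ (O θ).real {S | α * P.rStar θ ≤ P.r θ S}

end Problem

/-- The counters of Combinatorial Thompson Sampling: the success counts `s` and the failure
counts `f` of all the arms. -/
abbrev Counters (m : ℕ) : Type := (Fin m → ℕ) × (Fin m → ℕ)

/-- The counters after an epoch with states `x` and set of triggered arms `τ`. -/
def Counters.update {m : ℕ} (c : Counters m) (x : States m) (τ : Finset (Fin m)) : Counters m :=
  (fun i => c.1 i + if i ∈ τ ∧ x i = true then 1 else 0,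
   fun i => c.2 i + if i ∈ τ ∧ x i = false then 1 else 0)

/-- The law of the sample `ν`: the `ν i` are independent with law `Beta (s i + 1, f i + 1)`.
As this law lives on `[0, 1]`, the projection to `[0, 1]` only changes the type of `ν i`. -/
noncomputable def posterior (m : ℕ) : Kernel (Counters m) (MeanVec m) :=
  Kernel.ofFunOfCountable fun c => Measure.pi fun i =>
    (betaMeasure ((c.1 i : ℝ) + 1) ((c.2 i : ℝ) + 1)).map (Set.projIcc (0 : ℝ) 1 zero_le_one)

namespace Problem

variable {m : ℕ} {A : Type*} [Countable A] [MeasurableSpace A] [DiscreteMeasurableSpace A]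
  (P : Problem m A)

/-- One epoch of Combinatorial Thompson Sampling, as the joint law of the selected action and of
the new counters, given the old counters `c`: sample `ν` from `posterior m c`, call `O` with
input `ν` to get `S`, observe the states of the triggered arms and update their counters. -/
noncomputable def epoch (O : Kernel (MeanVec m) A) (μ : MeanVec m) :
    Kernel (Counters m) (A × Counters m) :=
  Kernel.ofFunOfCountable fun c =>
    ((posterior m c).bind O).bind fun S =>
      (P.outcome μ S).map fun z => (S, c.update z.1 z.2)

/-- The joint law of the first `n` selected actions and of the counters after epoch `n`. -/
noncomputable def run (O : Kernel (MeanVec m) A) (μ : MeanVec m) :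
    (n : ℕ) → Measure ((Fin n → A) × Counters m)
  | 0 => Measure.dirac (Fin.elim0, (fun _ => 0, fun _ => 0))
  | n + 1 => (run O μ n ⊗ₘ (P.epoch O μ).comap Prod.snd measurable_snd).map
      fun w => (Fin.snoc (α := fun _ => A) w.1.1 w.2.1, w.2.2)

/-- The `(α, β)`-approximation regret by epoch `T` of Combinatorial Thompson Sampling with
approximation algorithm `O`, when the expectation vector is `μ`. -/
noncomputable def regretCTS (O : Kernel (MeanVec m) A) (μ : MeanVec m) (α β : ℝ) (T : ℕ) : ℝ :=
  T * α * β * P.rStar μ - ∫ h, ∑ t, P.r μ (h.1 t) ∂(P.run O μ T)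

end Problem

end CMAB

/-! The proof charges the regret to the epochs whose sample `ν` is `δ`-far from `μ` in some
coordinate, and shows that the probability of such an epoch decays geometrically. If all coordinates
are closer than `δ`, smoothness makes every successful oracle answer non-bad
(`notMem_bad_of_close`), so the conditional expected reward is at least `αβ r*_μ`; otherwise an
epoch costs at most `gapMax`.

Given the counters, each tail of a Beta sample is at most an exponential `potential` of the counts:
Beta tails are binomial tails, which Chernoff and Hoeffding control. Being the exponential of a
linear function of the counts, the potential is multiplied at each observation by a factor of
conditional mean at most `exp (-d²)`. An arm is observed with probability at least `pstar`,
independently of its own state, so each epoch contracts the expected potential by `q = 1 - pstar (1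
- exp (-d²))`, whatever action is played (`lintegral_potential_run_le`).

After `n` epochs a far sample thus has probability at most `2m qⁿ`. Summing the geometric series
gives `2m / (pstar (1 - exp (-δ²)))`, which is below the last summand of the claimed bound for every
`η`. -/

namespace CMAB

/-! ### Beta tails through binomial tails -/

open Polynomial in
theorem derivative_sum_bernstein (n s : ℕ) :
    derivative (∑ j ∈ Finset.range (s + 1), bernsteinPolynomial ℝ (n + 1) j) =
      -((n : ℝ[X]) + 1) * bernsteinPolynomial ℝ n s := by
  induction s with
  | zero => simp [bernsteinPolynomial.derivative_zero]
  | succ s ih =>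
    rw [Finset.sum_range_succ, derivative_add, ih, bernsteinPolynomial.derivative_succ]
    push_cast
    simp
    ring

/-- Hoeffding's lemma for a Bernoulli variable, obtained from the sub-Gaussian bound for variables
in `[0, 1]`. It serves twice: for the Beta tail and for the drift of the potential. -/
theorem one_sub_add_mul_exp_le {p : ℝ} (hp0 : 0 ≤ p) (hp1 : p ≤ 1) (l : ℝ) :
    1 - p + p * Real.exp l ≤ Real.exp (l * p + l ^ 2 / 8) := by
  set ρ : Measure ℝ := ENNReal.ofReal p • Measure.dirac 1 + ENNReal.ofReal (1 - p) • Measure.dirac 0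
    with hρ
  have hprob : IsProbabilityMeasure ρ := by
    constructor
    simp [hρ, ← ENNReal.ofReal_add hp0 (sub_nonneg.2 hp1)]
  have hint (g : ℝ → ℝ) : ∫ x, g x ∂ρ = p * g 1 + (1 - p) * g 0 := by
    rw [hρ, integral_add_measure, integral_smul_measure, integral_smul_measure, integral_dirac,
      integral_dirac, ENNReal.toReal_ofReal hp0, ENNReal.toReal_ofReal (sub_nonneg.2 hp1)]
    · simp
    · exact (integrable_dirac (by simp)).smul_measure (by simp)
    · exact (integrable_dirac (by simp)).smul_measure (by simp)
  have hb : ∀ᵐ x ∂ρ, id x ∈ Set.Icc (0 : ℝ) 1 := by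
    rw [hρ, ae_add_measure_iff]
    constructor <;> refine Measure.ae_smul_measure ?_ _ <;> rw [ae_dirac_eq] <;> simp
  have h := (hasSubgaussianMGF_of_mem_Icc (X := id) aemeasurable_id hb).mgf_le l
  simp only [mgf, hint, id] at h
  have h2 := mul_le_mul_of_nonneg_left h (Real.exp_pos (l * p)).le
  rw [← Real.exp_add] at h2
  have e1 : Real.exp (l * (1 - (p * 1 + (1 - p) * 0))) = Real.exp l * (Real.exp (l * p))⁻¹ := by
    rw [← Real.exp_neg, ← Real.exp_add]; ring_nf
  have e2 : Real.exp (l * (0 - (p * 1 + (1 - p) * 0))) = (Real.exp (l * p))⁻¹ := by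
    rw [← Real.exp_neg]; ring_nf
  have e3 : (((‖(1 : ℝ) - 0‖₊ / 2) ^ 2 : ℝ≥0) : ℝ) * l ^ 2 / 2 = l ^ 2 / 8 := by
    simp; ring
  rw [e1, e2, e3] at h2
  refine le_of_eq_of_le ?_ h2
  field_simp
  ring

/-- Chernoff bound for the lower binomial tail: the indicator of `j ≤ s` is at most `exp (l (s -
j))`, and the binomial theorem sums the tilted weights. -/
theorem sum_bernstein_le {n s : ℕ} {y : ℝ} (hy0 : 0 ≤ y) (hy1 : y ≤ 1) {l : ℝ} (hl : 0 ≤ l)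
    (hs : s ≤ n) :
    ∑ j ∈ Finset.range (s + 1), (bernsteinPolynomial ℝ n j).eval y ≤
      Real.exp (l * (s - y * n) + n * (l ^ 2 / 8)) := by
  have hle : ∑ j ∈ Finset.range (s + 1), (bernsteinPolynomial ℝ n j).eval y ≤
      ∑ j ∈ Finset.range (n + 1), Real.exp (l * s) *
        ((y * Real.exp (-l)) ^ j * (1 - y) ^ (n - j) * n.choose j) := by
    refine (Finset.sum_le_sum (g := fun j => Real.exp (l * s) *
        ((y * Real.exp (-l)) ^ j * (1 - y) ^ (n - j) * n.choose j)) fun j hj => ?_).trans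
      (Finset.sum_le_sum_of_subset_of_nonneg (by simpa using hs) fun j _ _ => ?_)
    · have hj' : (j : ℝ) ≤ s := by exact_mod_cast Nat.lt_succ_iff.1 (Finset.mem_range.1 hj)
      have h1 : 1 ≤ Real.exp (l * s) * Real.exp (-l) ^ j := by
        rw [← Real.exp_nat_mul, ← Real.exp_add]
        apply Real.one_le_exp
        nlinarith
      have h0 : 0 ≤ (n.choose j : ℝ) * y ^ j * (1 - y) ^ (n - j) := by
        have := sub_nonneg.2 hy1
        positivity
      simp only [bernsteinPolynomial, Polynomial.eval_mul, Polynomial.eval_pow, Polynomial.eval_sub,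
        Polynomial.eval_one, Polynomial.eval_X, Polynomial.eval_natCast]
      calc _ ≤ _ := le_mul_of_one_le_left h0 h1
        _ = _ := by rw [mul_pow]; ring
    · have := sub_nonneg.2 hy1
      positivity
  refine hle.trans ?_
  rw [← Finset.mul_sum, ← add_pow]
  have h := one_sub_add_mul_exp_le hy0 hy1 (-l)
  have h' : (y * Real.exp (-l) + (1 - y)) ^ n ≤ Real.exp (-l * y + (-l) ^ 2 / 8) ^ n := by
    have := sub_nonneg.2 hy1
    gcongr
    linarith
  refine (mul_le_mul_of_nonneg_left h' (Real.exp_pos _).le).trans_eq ?_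
  rw [← Real.exp_nat_mul, ← Real.exp_add]
  ring_nf

theorem betaPDFReal_eq_bernstein (s f : ℕ) {x : ℝ} (hx : x ∈ Set.Ioo (0 : ℝ) 1) :
    betaPDFReal (s + 1) (f + 1) x =
      ((s + f : ℕ) + 1) * (bernsteinPolynomial ℝ (s + f) s).eval x := by
  rw [betaPDFReal, if_pos (Set.mem_Ioo.1 hx)]
  have h1 : (s : ℝ) + 1 + (f + 1) = ((s + f + 1 : ℕ) : ℝ) + 1 := by push_cast; ring
  have h2 : ((s + f).choose s : ℝ) = (s + f).factorial / (s.factorial * f.factorial) := by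
    rw [eq_div_iff (by positivity)]
    rw [← mul_assoc]
    exact_mod_cast Nat.choose_symm_add (a := s) (b := f) ▸
      Nat.add_choose_mul_factorial_mul_factorial s f
  simp only [beta, h1, Real.Gamma_nat_eq_factorial, bernsteinPolynomial, Polynomial.eval_mul,
    Polynomial.eval_pow, Polynomial.eval_sub, Polynomial.eval_one, Polynomial.eval_X,
    Polynomial.eval_natCast, add_sub_cancel_right, Real.rpow_natCast, h2, Nat.factorial_succ,
    add_tsub_cancel_left]
  push_cast
  field_simp

/-- Beta–binomial duality. The Beta density is a multiple of one Bernstein polynomial, and the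
derivative of the partial Bernstein sum telescopes to minus that multiple. -/
theorem betaMeasure_Ici_eq (s f : ℕ) {y : ℝ} (hy0 : 0 ≤ y) (hy1 : y ≤ 1) :
    betaMeasure (s + 1) (f + 1) (Set.Ici y) =
      ENNReal.ofReal (∑ j ∈ Finset.range (s + 1), (bernsteinPolynomial ℝ (s + f + 1) j).eval y) := by
  have hnn (x : ℝ) (hx : x ∈ Set.Ioo y 1) :
      0 ≤ ((s + f : ℕ) + 1) * (bernsteinPolynomial ℝ (s + f) s).eval x := by
    have hx' : x ∈ Set.Ioo (0 : ℝ) 1 := ⟨hy0.trans_lt hx.1, hx.2⟩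
    rw [← betaPDFReal_eq_bernstein s f hx']
    exact (betaPDFReal_pos hx'.1 hx'.2 (by positivity) (by positivity)).le
  have hcont : Continuous fun x : ℝ =>
      ((s + f : ℕ) + 1 : ℝ) * (bernsteinPolynomial ℝ (s + f) s).eval x := by fun_prop
  have hint : ∫ x in y..1, ((s + f : ℕ) + 1 : ℝ) * (bernsteinPolynomial ℝ (s + f) s).eval x =
      ∑ j ∈ Finset.range (s + 1), (bernsteinPolynomial ℝ (s + f + 1) j).eval y := by
    have hd (x : ℝ) : HasDerivAt (fun x => -(∑ j ∈ Finset.range (s + 1),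
        bernsteinPolynomial ℝ (s + f + 1) j).eval x)
        (((s + f : ℕ) + 1 : ℝ) * (bernsteinPolynomial ℝ (s + f) s).eval x) x := by
      refine (Polynomial.hasDerivAt _ x).neg.congr_deriv ?_
      rw [derivative_sum_bernstein]
      simp
      ring
    rw [intervalIntegral.integral_eq_sub_of_hasDerivAt (fun x _ => hd x)
      (hcont.intervalIntegrable _ _)]
    -- The boundary term at `1` vanishes because every index satisfies `j ≤ s < s + f + 1`.
    simp only [Polynomial.eval_finsetSum, bernsteinPolynomial.eval_at_1]
    rw [Finset.sum_eq_zero (f := fun j => if j = s + f + 1 then (1 : ℝ) else 0)]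
    · simp
    · intro j hj
      rw [if_neg]
      have := Finset.mem_range.1 hj
      omega
  rw [betaMeasure, withDensity_apply _ measurableSet_Ici, ← hint,
    intervalIntegral.integral_of_le hy1, integral_Ioc_eq_integral_Ioo,
    ofReal_integral_eq_lintegral_ofReal (hcont.integrableOn_Ioc.mono_set Set.Ioo_subset_Ioc_self)
      (ae_restrict_of_forall_mem measurableSet_Ioo hnn),
    ← setLIntegral_congr Ioi_ae_eq_Ici, Set.Ioo, Set.ofPred_and, Set.inter_comm]
  change _ = ∫⁻ x in Set.Iio 1 ∩ Set.Ioi y, _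
  rw [← setLIntegral_indicator measurableSet_Iio]
  refine setLIntegral_congr_fun measurableSet_Ioi fun x hx => ?_
  by_cases h1 : x < 1
  · rw [Set.indicator_of_mem (Set.mem_Iio.2 h1), betaPDF,
      betaPDFReal_eq_bernstein s f ⟨hy0.trans_lt hx, h1⟩]
  · rw [Set.indicator_of_notMem (by simpa using h1), betaPDF_eq_zero_of_one_le (not_lt.1 h1)]

/-- The tilt `l = 2d` is fixed, so that the exponent stays linear in the counts. Per observation the
tail bound and the later drift bound together cost `-l d + l²/8 + l²/8`, which is minimal, equal to
`-d²`, at `l = 2d`. The duality has `s + f + 1` trials; dropping one only weakens the bound. -/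
theorem betaMeasure_Ici_le (s f : ℕ) {p d : ℝ} (hp : 0 ≤ p) (hd : 0 ≤ d) :
    betaMeasure (s + 1) (f + 1) (Set.Ici (p + d)) ≤
      ENNReal.ofReal (Real.exp (2 * d * (s - p * (s + f)) - 3 / 2 * d ^ 2 * (s + f))) := by
  rcases le_or_gt (p + d) 1 with h1 | h1
  · rw [betaMeasure_Ici_eq s f (by positivity) h1]
    refine ENNReal.ofReal_le_ofReal ((sum_bernstein_le (l := 2 * d) (by positivity) h1
      (by positivity) (by omega)).trans (Real.exp_le_exp.2 ?_))
    push_cast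
    nlinarith [mul_nonneg hd hp, sq_nonneg d]
  · rw [betaMeasure, withDensity_apply _ measurableSet_Ici, setLIntegral_eq_zero measurableSet_Ici]
    · exact zero_le
    · intro x hx
      exact betaPDF_eq_zero_of_one_le (h1.le.trans hx)

theorem betaPDF_one_sub (a b x : ℝ) : betaPDF a b (1 - x) = betaPDF b a x := by
  simp only [betaPDF, betaPDFReal, beta, sub_sub_cancel, sub_pos, sub_lt_self_iff, add_comm a b,
    mul_comm (Real.Gamma a)]
  refine congrArg _ (if_congr and_comm ?_ rfl)
  ring

theorem betaMeasure_Iic_one_sub (a b y : ℝ) :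
    betaMeasure a b (Set.Iic (1 - y)) = betaMeasure b a (Set.Ici y) := by
  rw [betaMeasure, betaMeasure, withDensity_apply _ measurableSet_Ici,
    withDensity_apply _ measurableSet_Iic,
    ← (Measure.measurePreserving_sub_left volume (1 : ℝ)).setLIntegral_comp_preimage measurableSet_Iic
      (by unfold betaPDF; fun_prop)]
  simp only [betaPDF_one_sub]
  congr 2
  ext x
  simp

/-! ### The exponential potential and the posterior sample -/

/-- The number of observations of arm `i` in state `b`. -/
def Counters.count {m : ℕ} (c : Counters m) (b : Bool) (i : Fin m) : ℕ :=
  if b then c.1 i else c.2 i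

/-- The probability that an arm with expectation `p` is in state `b`. -/
def stateProb (p : ℝ) (b : Bool) : ℝ := if b then p else 1 - p

/-- An exponential potential which dominates the probability that the sample of arm `i` deviates
by at least `d` towards `b`, when the expectation of the arm is `p`. -/
noncomputable def potential {m : ℕ} (p d : ℝ) (b : Bool) (i : Fin m) (c : Counters m) : ℝ :=
  Real.exp (2 * d * (c.count b i - stateProb p b * (c.1 i + c.2 i))
    - 3 / 2 * d ^ 2 * (c.1 i + c.2 i))

theorem posterior_apply {m : ℕ} (c : Counters m) : posterior m c = Measure.pi fun i =>
    (betaMeasure ((c.1 i : ℝ) + 1) ((c.2 i : ℝ) + 1)).map (Set.projIcc (0 : ℝ) 1 zero_le_one) :=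
  rfl

instance {m : ℕ} (c : Counters m) (i : Fin m) : IsProbabilityMeasure
    ((betaMeasure ((c.1 i : ℝ) + 1) ((c.2 i : ℝ) + 1)).map
      (Set.projIcc (0 : ℝ) 1 zero_le_one)) := by
  have := isProbabilityMeasureBeta (α := (c.1 i : ℝ) + 1) (β := (c.2 i : ℝ) + 1)
    (by positivity) (by positivity)
  exact Measure.isProbabilityMeasure_map continuous_projIcc.measurable.aemeasurable

instance {m : ℕ} : IsMarkovKernel (posterior m) :=
  ⟨fun c => by rw [posterior_apply]; infer_instance⟩

theorem posterior_preimage {m : ℕ} (c : Counters m) (i : Fin m) {B : Set unitInterval}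
    (hB : MeasurableSet B) : posterior m c {ν | ν i ∈ B} =
      betaMeasure ((c.1 i : ℝ) + 1) ((c.2 i : ℝ) + 1)
        (Set.projIcc (0 : ℝ) 1 zero_le_one ⁻¹' B) := by
  rw [posterior_apply, ← Measure.map_apply continuous_projIcc.measurable hB,
    ← (measurePreserving_eval (fun i => (betaMeasure ((c.1 i : ℝ) + 1) ((c.2 i : ℝ) + 1)).map
      (Set.projIcc (0 : ℝ) 1 zero_le_one)) i).measure_preimage hB.nullMeasurableSet]
  rfl

theorem posterior_abs_sub_le {m : ℕ} (c : Counters m) (i : Fin m) (p : unitInterval) {d : ℝ}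
    (hd : 0 < d) : posterior m c {ν | d ≤ |(ν i : ℝ) - p|} ≤
      ENNReal.ofReal (potential p d true i c) + ENNReal.ofReal (potential p d false i c) := by
  have hB : MeasurableSet {x : unitInterval | d ≤ |(x : ℝ) - p|} :=
    measurableSet_le measurable_const (by fun_prop)
  -- Clamping to `[0, 1]` creates no new deviations: `p` lies in `[0, 1]` and `d > 0`, so a point
  -- clamped to an endpoint was at least as far from `p`, on the same side.
  have hsub : Set.projIcc (0 : ℝ) 1 zero_le_one ⁻¹' {x : unitInterval | d ≤ |(x : ℝ) - p|} ⊆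
      Set.Ici (p + d) ∪ Set.Iic (1 - (1 - p + d)) := by
    intro x hx
    have hp0 := p.2.1
    have hp1 := p.2.2
    simp only [Set.mem_preimage, Set.mem_ofPred_eq, Set.coe_projIcc, le_abs] at hx
    simp only [Set.mem_union, Set.mem_Ici, Set.mem_Iic]
    rcases hx with hx | hx
    · left
      have := lt_max_iff.1 (show 0 < max (0 : ℝ) (min 1 x) by linarith)
      rw [max_eq_right ((this.resolve_left (lt_irrefl 0)).le)] at hx
      linarith [min_le_right 1 x]
    · right
      have h1 : max 0 (min 1 x) ≤ 1 - (1 - p + d) := by linarith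
      have h2 := (le_max_right 0 (min 1 x)).trans h1
      rcases min_le_iff.1 h2 with h | h
      · linarith
      · exact h
  refine (posterior_preimage c i hB).trans_le ?_
  refine (measure_mono hsub).trans ((measure_union_le _ _).trans (add_le_add ?_ ?_))
  · exact betaMeasure_Ici_le _ _ p.2.1 hd.le
  -- The reflection `x ↦ 1 - x` swaps successes and failures and turns the lower tail into an upper
  -- one.
  · rw [betaMeasure_Iic_one_sub]
    refine (betaMeasure_Ici_le _ _ (sub_nonneg.2 p.2.2) hd.le).trans_eq ?_
    simp only [potential, Counters.count, stateProb]
    rw [add_comm (c.2 i : ℝ)]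
    rfl

theorem stateProb_nonneg (p : unitInterval) (b : Bool) : 0 ≤ stateProb p b := by
  cases b
  · exact sub_nonneg.2 p.2.2
  · exact p.2.1

theorem stateProb_le_one (p : unitInterval) (b : Bool) : stateProb p b ≤ 1 := by
  cases b
  · exact sub_le_self _ p.2.1
  · exact p.2.2

theorem stateProb_not (p : ℝ) (b : Bool) : stateProb p (!b) = 1 - stateProb p b := by
  cases b <;> simp [stateProb]

theorem potential_update {m : ℕ} (p d : ℝ) (b : Bool) (i : Fin m) (c : Counters m)
    (x : States m) (τ : Finset (Fin m)) :
    potential p d b i (c.update x τ) = potential p d b i c *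
      if i ∈ τ then
        Real.exp ((if x i = b then 2 * d else 0) - 2 * d * stateProb p b - 3 / 2 * d ^ 2)
      else 1 := by
  by_cases hi : i ∈ τ
  · rw [if_pos hi, potential, potential, ← Real.exp_add]
    congr 1
    cases b <;> cases hx : x i <;> simp [Counters.update, Counters.count, hi, hx] <;> ring
  · cases b <;> simp [potential, Counters.update, Counters.count, hi]

/-! ### Contraction of the potential along the run -/

namespace Problem

variable {m : ℕ} {A : Type*} (P : Problem m A)

instance (θ : MeanVec m) (S : A) : IsProbabilityMeasure (P.outcome θ S) := by
  unfold outcome; infer_instance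

theorem outcome_map_fst (θ : MeanVec m) (S : A) :
    (P.outcome θ S).map Prod.fst = (P.stateLaw θ).toMeasure := by
  rw [outcome, PMF.toMeasure_map _ _ measurable_fst, PMF.map_bind]
  simp only [PMF.map_comp]
  have : ∀ x : States m, (P.trig S x).map (Prod.fst ∘ fun τ => (x, τ)) = PMF.pure x := fun x =>
    PMF.map_const _ x
  simp only [this, PMF.bind_pure]

theorem outcome_state_true (θ : MeanVec m) (S : A) (i : Fin m) :
    (P.outcome θ S).real {z | z.1 i = true} = θ i := by
  rw [← P.mean_eq θ i, ← P.outcome_map_fst θ S]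
  have hs : MeasurableSet {x : States m | x i = true} := .of_discrete
  have : (fun x : States m => if x i = true then (1 : ℝ) else 0) =
      {x : States m | x i = true}.indicator 1 := by
    ext x; simp [Set.indicator]
  rw [this, integral_indicator_one hs, map_measureReal_apply measurable_fst hs]
  rfl

theorem outcome_trig_inter_state {μ : MeanVec m} (hind : P.OwnStateIndep μ) (S : A) (i : Fin m)
    (b : Bool) : (P.outcome μ S).real ({z | i ∈ z.2} ∩ {z | z.1 i = b}) =
      P.trigProb μ S i * stateProb (μ i) b := by
  have ht : (P.outcome μ S).real ({z | i ∈ z.2} ∩ {z | z.1 i = true}) =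
      P.trigProb μ S i * μ i := by
    rw [← P.outcome_state_true μ S i, trigProb, measureReal_def, (hind S i).measure_inter_eq_mul,
      ENNReal.toReal_mul]
    rfl
  cases b
  · have hs : MeasurableSet {z : States m × Finset (Fin m) | z.1 i = true} := .of_discrete
    have h := measureReal_inter_add_sdiff (μ := P.outcome μ S)
      (s := {z : States m × Finset (Fin m) | i ∈ z.2}) hs
    have e : {z : States m × Finset (Fin m) | i ∈ z.2} \ {z | z.1 i = true} =
        {z | i ∈ z.2} ∩ {z | z.1 i = false} := by
      ext z; simp
    have hw : (P.outcome μ S).real {z | i ∈ z.2} = P.trigProb μ S i := rfl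
    rw [ht, e, hw] at h
    simp only [stateProb, Bool.false_eq_true, if_false]
    linear_combination h
  · simpa [stateProb] using ht

/-- Independence of triggering and own state gives the mean `1 - w + w E`, where `w` is the
triggering probability and `E` is the mean factor of an observation. Hoeffding's lemma at `2d` gives
`E ≤ exp (d²/2 - 3d²/2) = exp (-d²)`. -/
theorem integral_potential_factor_le {μ : MeanVec m} (hind : P.OwnStateIndep μ) {pstar : ℝ}
    (S : A) (i : Fin m) (htrig : pstar ≤ P.trigProb μ S i) (d : ℝ) (b : Bool) :
    ∫ z, (if i ∈ z.2 then
        Real.exp ((if z.1 i = b then 2 * d else 0) - 2 * d * stateProb (μ i) b - 3 / 2 * d ^ 2)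
      else 1) ∂(P.outcome μ S) ≤ 1 - pstar * (1 - Real.exp (-d ^ 2)) := by
  set π := stateProb (μ i) b with hπ
  set w := P.trigProb μ S i with hw
  have hdecomp (z : States m × Finset (Fin m)) : (if i ∈ z.2 then
        Real.exp ((if z.1 i = b then 2 * d else 0) - 2 * d * π - 3 / 2 * d ^ 2)
      else 1) = 1 + (Set.indicator ({z | i ∈ z.2} ∩ {z | z.1 i = b}) (fun _ =>
          Real.exp (2 * d - 2 * d * π - 3 / 2 * d ^ 2) - 1) z +
        Set.indicator ({z | i ∈ z.2} ∩ {z | z.1 i = !b}) (fun _ =>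
          Real.exp (0 - 2 * d * π - 3 / 2 * d ^ 2) - 1) z) := by
    by_cases hi : i ∈ z.2 <;> cases hz : z.1 i <;> cases b <;> simp [hi, hz]
  have hint : ∫ z, (if i ∈ z.2 then
        Real.exp ((if z.1 i = b then 2 * d else 0) - 2 * d * π - 3 / 2 * d ^ 2)
      else 1) ∂(P.outcome μ S) =
      1 + (w * π * (Real.exp (2 * d - 2 * d * π - 3 / 2 * d ^ 2) - 1) +
        w * (1 - π) * (Real.exp (0 - 2 * d * π - 3 / 2 * d ^ 2) - 1)) := by
    simp only [hdecomp]
    rw [integral_add (.of_finite) (.of_finite), integral_add (.of_finite) (.of_finite),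
      integral_indicator_const _ .of_discrete, integral_indicator_const _ .of_discrete,
      P.outcome_trig_inter_state hind, P.outcome_trig_inter_state hind, stateProb_not]
    simp [hπ, hw]
  have hH := one_sub_add_mul_exp_le (stateProb_nonneg (μ i) b) (stateProb_le_one (μ i) b) (2 * d)
  rw [← hπ] at hH
  have h1 : π * Real.exp (2 * d - 2 * d * π - 3 / 2 * d ^ 2) +
      (1 - π) * Real.exp (0 - 2 * d * π - 3 / 2 * d ^ 2) ≤ Real.exp (-d ^ 2) := by
    have h2 := mul_le_mul_of_nonneg_left hH (Real.exp_pos (- 2 * d * π - 3 / 2 * d ^ 2)).le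
    rw [← Real.exp_add] at h2
    calc _ = Real.exp (- 2 * d * π - 3 / 2 * d ^ 2) * (1 - π + π * Real.exp (2 * d)) := by
          rw [mul_add, mul_left_comm _ π, ← Real.exp_add]
          ring_nf
      _ ≤ _ := h2
      _ = _ := by ring_nf
  have h3 : Real.exp (-d ^ 2) ≤ 1 := Real.exp_le_one_iff.2 (by nlinarith)
  have hw0 : 0 ≤ w := measureReal_nonneg
  rw [hint]
  -- As `exp (-d²) ≤ 1`, the bound decreases in `w`, so `w` may be replaced by `pstar`.
  nlinarith [mul_le_mul_of_nonneg_left h1 hw0, mul_le_mul_of_nonneg_right htrig (sub_nonneg.2 h3)]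

theorem lintegral_potential_update_le {μ : MeanVec m} (hind : P.OwnStateIndep μ) {pstar : ℝ}
    (S : A) (i : Fin m) (htrig : pstar ≤ P.trigProb μ S i) (d : ℝ) (b : Bool) (c : Counters m) :
    ∫⁻ z, ENNReal.ofReal (potential (μ i) d b i (c.update z.1 z.2)) ∂(P.outcome μ S) ≤
      ENNReal.ofReal (1 - pstar * (1 - Real.exp (-d ^ 2))) *
        ENNReal.ofReal (potential (μ i) d b i c) := by
  have hg (c : Counters m) : 0 ≤ potential (μ i) d b i c := (Real.exp_pos _).le
  rw [← ofReal_integral_eq_lintegral_ofReal .of_finite (ae_of_all _ fun z => hg _),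
    mul_comm, ← ENNReal.ofReal_mul (hg c)]
  refine ENNReal.ofReal_le_ofReal ?_
  simp only [potential_update]
  rw [integral_const_mul]
  exact mul_le_mul_of_nonneg_left (P.integral_potential_factor_le hind S i htrig d b) (hg c)

variable [Countable A] [MeasurableSpace A] [DiscreteMeasurableSpace A]
  (O : Kernel (MeanVec m) A) (μ : MeanVec m)

theorem lintegral_epoch (c : Counters m) (F : A × Counters m → ENNReal) :
    ∫⁻ y, F y ∂(P.epoch O μ c) =
      ∫⁻ ν, ∫⁻ S, ∫⁻ z, F (S, c.update z.1 z.2) ∂(P.outcome μ S) ∂(O ν) ∂(posterior m c) := by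
  change ∫⁻ y, F y ∂(((posterior m c).bind O).bind fun S =>
      (P.outcome μ S).map fun z => (S, c.update z.1 z.2)) = _
  rw [Measure.lintegral_bind (Measurable.of_discrete.aemeasurable)
    (Measurable.of_discrete.aemeasurable), Measure.lintegral_bind O.measurable.aemeasurable
    (Measurable.of_discrete.aemeasurable)]
  refine lintegral_congr fun ν => lintegral_congr fun S => ?_
  exact lintegral_map .of_discrete .of_discrete

theorem isMarkovKernel_epoch [IsMarkovKernel O] : IsMarkovKernel (P.epoch O μ) :=
  ⟨fun c => ⟨by
    rw [← lintegral_one, lintegral_epoch]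
    simp⟩⟩

theorem isProbabilityMeasure_run [IsMarkovKernel O] (n : ℕ) :
    IsProbabilityMeasure (P.run O μ n) := by
  have := P.isMarkovKernel_epoch O μ
  induction n with
  | zero => rw [run]; infer_instance
  | succ n ih =>
    rw [run]
    exact Measure.isProbabilityMeasure_map (Measurable.of_discrete.aemeasurable)

theorem lintegral_run_succ [IsMarkovKernel O] (n : ℕ)
    (F : (Fin (n + 1) → A) × Counters m → ENNReal) :
    ∫⁻ h, F h ∂(P.run O μ (n + 1)) =
      ∫⁻ h, ∫⁻ y, F (Fin.snoc (α := fun _ => A) h.1 y.1, y.2) ∂(P.epoch O μ h.2)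
        ∂(P.run O μ n) := by
  have := P.isMarkovKernel_epoch O μ
  have := P.isProbabilityMeasure_run O μ n
  rw [run, lintegral_map .of_discrete .of_discrete, Measure.lintegral_compProd .of_discrete]
  rfl

/-- The one-epoch contraction is uniform in the action, so it survives averaging over the sample and
the oracle; the potential starts at `1`. -/
theorem lintegral_potential_run_le [IsMarkovKernel O] {μ : MeanVec m} (hind : P.OwnStateIndep μ)
    {pstar : ℝ} (i : Fin m) (htrig : ∀ S, pstar ≤ P.trigProb μ S i) (d : ℝ) (b : Bool) (n : ℕ) :
    ∫⁻ h, ENNReal.ofReal (potential (μ i) d b i h.2) ∂(P.run O μ n) ≤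
      ENNReal.ofReal (1 - pstar * (1 - Real.exp (-d ^ 2))) ^ n := by
  induction n with
  | zero => simp [run, potential, Counters.count]
  | succ n ih =>
    rw [lintegral_run_succ, pow_succ']
    refine le_trans ?_ (mul_le_mul_right ih _)
    rw [← lintegral_const_mul _ .of_discrete]
    refine lintegral_mono fun h => ?_
    rw [lintegral_epoch]
    refine (lintegral_mono fun ν => lintegral_mono fun S =>
      P.lintegral_potential_update_le hind S i (htrig S) d b h.2).trans ?_
    simp

theorem lintegral_posterior_run_le [IsMarkovKernel O] {μ : MeanVec m} (hind : P.OwnStateIndep μ)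
    {pstar : ℝ} (htrig : ∀ S i, pstar ≤ P.trigProb μ S i) {d : ℝ} (hd : 0 < d) (n : ℕ) :
    ∫⁻ h, posterior m h.2 {ν | ∃ i, d ≤ |(ν i : ℝ) - μ i|} ∂(P.run O μ n) ≤
      2 * m * ENNReal.ofReal (1 - pstar * (1 - Real.exp (-d ^ 2))) ^ n := by
  have hset : {ν : MeanVec m | ∃ i, d ≤ |(ν i : ℝ) - μ i|} =
      ⋃ i, {ν : MeanVec m | d ≤ |(ν i : ℝ) - μ i|} := by
    ext ν; simp
  calc _ ≤ ∫⁻ h, ∑ i, (ENNReal.ofReal (potential (μ i) d true i h.2) +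
        ENNReal.ofReal (potential (μ i) d false i h.2)) ∂(P.run O μ n) := by
        refine lintegral_mono fun h => ?_
        rw [hset]
        exact (measure_iUnion_fintype_le _ _).trans
          (Finset.sum_le_sum fun i _ => posterior_abs_sub_le h.2 i (μ i) hd)
    _ ≤ ∑ _i : Fin m, 2 * ENNReal.ofReal (1 - pstar * (1 - Real.exp (-d ^ 2))) ^ n := by
        rw [lintegral_finsetSum _ fun i _ => .of_discrete]
        refine Finset.sum_le_sum fun i _ => ?_
        rw [lintegral_add_left .of_discrete, two_mul]
        exact add_le_add (P.lintegral_potential_run_le O hind i (fun S => htrig S i) d true n)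
          (P.lintegral_potential_run_le O hind i (fun S => htrig S i) d false n)
    _ = _ := by
        simp
        ring

end Problem

/-! ### From far samples to regret -/

namespace Problem

variable {m : ℕ} {A : Type*} (P : Problem m A)

theorem r_nonneg (θ : MeanVec m) (S : A) : 0 ≤ P.r θ S := integral_nonneg fun _ => NNReal.coe_nonneg _

theorem rStar_nonneg (θ : MeanVec m) : 0 ≤ P.rStar θ := Real.iSup_nonneg (P.r_nonneg θ)

theorem gapMax_nonneg (μ : MeanVec m) (α : ℝ) : 0 ≤ P.gapMax μ α := by
  refine Real.sSup_nonneg ?_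
  rintro _ ⟨S, hS, rfl⟩
  exact (sub_pos.2 hS).le

theorem gap_le_gapMax [Finite A] (μ : MeanVec m) (α : ℝ) (S : A) :
    P.gap μ α S ≤ P.gapMax μ α := by
  by_cases hS : S ∈ P.bad μ α
  · exact le_csSup (Set.toFinite _).bddAbove ⟨S, hS, rfl⟩
  · exact (sub_nonpos.2 (not_lt.1 hS)).trans (P.gapMax_nonneg μ α)

theorem gapMin_le_gap [Finite A] {μ : MeanVec m} {α : ℝ} {S : A} (hS : S ∈ P.bad μ α) :
    P.gapMin μ α ≤ P.gap μ α S :=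
  csInf_le (Set.toFinite _).bddBelow ⟨S, hS, rfl⟩

theorem gapMin_pos [Finite A] {μ : MeanVec m} {α : ℝ} (h : (P.bad μ α).Nonempty) :
    0 < P.gapMin μ α := by
  obtain ⟨S, hS, hSe⟩ := (h.image (P.gap μ α)).csInf_mem (Set.toFinite _)
  rw [gapMin, ← hSe]
  exact sub_pos.2 hS

/-- Passing from `μ` to `ν` and back loses `α f Δ` in the optimum and `f Δ` in the reward of `S`, in
total less than `2 f δ = gapMin`; a bad action would lose at least `gapMin`. -/
theorem notMem_bad_of_close [Finite A] [Nonempty A] {f : ℝ≥0 → ℝ≥0} (hf : P.BoundedSmooth f)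
    {μ ν : MeanVec m} {α : ℝ} (hα0 : 0 ≤ α) (hα1 : α ≤ 1) {δ : ℝ≥0} (hδ0 : 0 < δ)
    (hδ : (f δ : ℝ) = P.gapMin μ α / 2) (hclose : ∀ i, |(ν i : ℝ) - μ i| < δ) {S : A}
    (hS : α * P.rStar ν ≤ P.r ν S) : S ∉ P.bad μ α := by
  intro hbad
  -- There are finitely many strict inequalities, so some `Δ < δ` still works. This makes `f Δ < f
  -- δ` strict, which the final contradiction needs.
  obtain ⟨Δ, hΔ0, hΔδ, hΔ⟩ : ∃ Δ : ℝ≥0, 0 < Δ ∧ Δ < δ ∧ ∀ i, |(ν i : ℝ) - μ i| ≤ Δ := by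
    have hev : ∀ᶠ x : ℝ in nhdsWithin (δ : ℝ) (Set.Iio (δ : ℝ)), 0 < x ∧ x < δ ∧
        ∀ i, |(ν i : ℝ) - μ i| ≤ x := by
      refine (eventually_nhdsWithin_of_eventually_nhds
        (lt_mem_nhds (NNReal.coe_pos.2 hδ0))).and (Filter.Eventually.and self_mem_nhdsWithin ?_)
      exact Filter.eventually_all.2 fun i => eventually_nhdsWithin_of_eventually_nhds
        ((lt_mem_nhds (hclose i)).mono fun _ h => h.le)
    obtain ⟨x, h0, h1, h2⟩ := hev.exists
    exact ⟨⟨x, h0.le⟩, h0, h1, h2⟩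
  have hfΔ : (f Δ : ℝ) < f δ := by exact_mod_cast hf.strictMono hΔδ
  have hb := hf.bound ν μ Δ hΔ0 hΔ
  have hstar : P.rStar μ ≤ P.rStar ν + f Δ := ciSup_le fun S' => by
    have h1 := (abs_le.1 (hb S')).1
    have h2 : P.r ν S' ≤ P.rStar ν := le_ciSup (Set.finite_range _).bddAbove S'
    linarith
  have h1 := (abs_le.1 (hb S)).2
  have h2 := P.gapMin_le_gap hbad
  have h3 := mul_le_mul_of_nonneg_left hstar hα0
  have h4 : α * (f Δ : ℝ) ≤ f Δ := mul_le_of_le_one_left (NNReal.coe_nonneg _) hα1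
  unfold gap at h2
  linarith

variable [Finite A] [MeasurableSpace A] [DiscreteMeasurableSpace A]

theorem integrable_sum_run (O : Kernel (MeanVec m) A) [IsMarkovKernel O] (μ : MeanVec m)
    (T : ℕ) : Integrable (fun h : (Fin T → A) × Counters m => ∑ t, P.r μ (h.1 t))
      (P.run O μ T) := by
  have := P.isProbabilityMeasure_run O μ T
  obtain ⟨C, hC⟩ := (Set.finite_range fun x : Fin T → A => ‖∑ t, P.r μ (x t)‖).bddAbove
  exact .of_bound Measurable.of_discrete.aestronglyMeasurable C
    (ae_of_all _ fun h => hC ⟨h.1, rfl⟩)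

/-- For a far `ν`, every action is within `gapMax` of `α r*_μ`. For a close one, the oracle's
success event has mass at least `β` and reward at least `α r*_μ` on it; elsewhere rewards are
nonnegative. -/
theorem le_lintegral_oracle [Nonempty A] {f : ℝ≥0 → ℝ≥0} (hf : P.BoundedSmooth f)
    {μ : MeanVec m} {α β : ℝ} (hα0 : 0 ≤ α) (hα1 : α ≤ 1) (hβ1 : β ≤ 1)
    {O : Kernel (MeanVec m) A} (hO : P.IsApproxOracle O α β) {δ : ℝ≥0} (hδ0 : 0 < δ)
    (hδ : (f δ : ℝ) = P.gapMin μ α / 2) (ν : MeanVec m) :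
    ENNReal.ofReal (α * β * P.rStar μ) ≤ ∫⁻ S, ENNReal.ofReal (P.r μ S) ∂(O ν) +
      ENNReal.ofReal (P.gapMax μ α) *
        {ν : MeanVec m | ∃ i, (δ : ℝ) ≤ |(ν i : ℝ) - μ i|}.indicator 1 ν := by
  have := hO.1
  have hαr : 0 ≤ α * P.rStar μ := mul_nonneg hα0 (P.rStar_nonneg μ)
  by_cases hν : ∃ i, (δ : ℝ) ≤ |(ν i : ℝ) - μ i|
  · rw [Set.indicator_of_mem (by exact hν), Pi.one_apply, mul_one]
    calc _ ≤ ∫⁻ _S, ENNReal.ofReal (α * β * P.rStar μ) ∂(O ν) := by simp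
      _ ≤ ∫⁻ S, (ENNReal.ofReal (P.r μ S) + ENNReal.ofReal (P.gapMax μ α)) ∂(O ν) := by
          refine lintegral_mono fun S => ?_
          rw [← ENNReal.ofReal_add (P.r_nonneg μ S) (P.gapMax_nonneg μ α)]
          refine ENNReal.ofReal_le_ofReal ?_
          have h := P.gap_le_gapMax μ α S
          unfold gap at h
          nlinarith
      _ = _ := by rw [lintegral_add_right _ measurable_const]; simp
  · push Not at hν
    refine le_add_right ?_
    have hsub : {S | α * P.rStar ν ≤ P.r ν S} ⊆ {S | α * P.rStar μ ≤ P.r μ S} := by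
      intro S hS
      have h : ¬ P.r μ S < α * P.rStar μ :=
        P.notMem_bad_of_close hf hα0 hα1 hδ0 hδ hν hS
      exact not_lt.1 h
    have hβ : ENNReal.ofReal β ≤ O ν {S | α * P.rStar μ ≤ P.r μ S} := by
      refine le_trans ?_ (measure_mono hsub)
      exact ENNReal.ofReal_le_of_le_toReal (hO.2 ν)
    calc _ = ENNReal.ofReal (α * P.rStar μ) * ENNReal.ofReal β := by
          rw [← ENNReal.ofReal_mul hαr, mul_right_comm]
      _ ≤ ENNReal.ofReal (α * P.rStar μ) * O ν {S | α * P.rStar μ ≤ P.r μ S} := by gcongr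
      _ = ∫⁻ _S in {S | α * P.rStar μ ≤ P.r μ S}, ENNReal.ofReal (α * P.rStar μ) ∂(O ν) := by
          rw [setLIntegral_const]
      _ ≤ ∫⁻ S in {S | α * P.rStar μ ≤ P.r μ S}, ENNReal.ofReal (P.r μ S) ∂(O ν) :=
          setLIntegral_mono .of_discrete fun S hS => ENNReal.ofReal_le_ofReal hS
      _ ≤ _ := setLIntegral_le_lintegral _ _

theorem le_lintegral_epoch [Nonempty A] {f : ℝ≥0 → ℝ≥0} (hf : P.BoundedSmooth f)
    {μ : MeanVec m} {α β : ℝ} (hα0 : 0 ≤ α) (hα1 : α ≤ 1) (hβ1 : β ≤ 1)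
    {O : Kernel (MeanVec m) A} (hO : P.IsApproxOracle O α β) {δ : ℝ≥0} (hδ0 : 0 < δ)
    (hδ : (f δ : ℝ) = P.gapMin μ α / 2) (c : Counters m) :
    ENNReal.ofReal (α * β * P.rStar μ) ≤ ∫⁻ y, ENNReal.ofReal (P.r μ y.1) ∂(P.epoch O μ c) +
      ENNReal.ofReal (P.gapMax μ α) *
        posterior m c {ν : MeanVec m | ∃ i, (δ : ℝ) ≤ |(ν i : ℝ) - μ i|} := by
  have hmeas : MeasurableSet {ν : MeanVec m | ∃ i, (δ : ℝ) ≤ |(ν i : ℝ) - μ i|} := by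
    have : {ν : MeanVec m | ∃ i, (δ : ℝ) ≤ |(ν i : ℝ) - μ i|} =
        ⋃ i, {ν : MeanVec m | (δ : ℝ) ≤ |(ν i : ℝ) - μ i|} := by
      ext ν; simp
    rw [this]
    exact .iUnion fun i => measurableSet_le measurable_const (by fun_prop)
  have h := lintegral_mono (μ := posterior m c) (P.le_lintegral_oracle hf hα0 hα1 hβ1 hO hδ0 hδ)
  rw [lintegral_add_right _ ((measurable_one.indicator hmeas).const_mul _),
    lintegral_const_mul _ (measurable_one.indicator hmeas), lintegral_indicator_one hmeas] at h
  rw [lintegral_epoch]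
  simpa using h

theorem le_lintegral_run [Nonempty A] {f : ℝ≥0 → ℝ≥0} (hf : P.BoundedSmooth f)
    {μ : MeanVec m} {α β : ℝ} (hα0 : 0 ≤ α) (hα1 : α ≤ 1) (hβ0 : 0 ≤ β) (hβ1 : β ≤ 1)
    {O : Kernel (MeanVec m) A} (hO : P.IsApproxOracle O α β) {δ : ℝ≥0} (hδ0 : 0 < δ)
    (hδ : (f δ : ℝ) = P.gapMin μ α / 2) (T : ℕ) :
    ENNReal.ofReal (T * α * β * P.rStar μ) ≤
      ∫⁻ h, ENNReal.ofReal (∑ t, P.r μ (h.1 t)) ∂(P.run O μ T) +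
      ENNReal.ofReal (P.gapMax μ α) * ∑ n ∈ Finset.range T,
        ∫⁻ h, posterior m h.2 {ν : MeanVec m | ∃ i, (δ : ℝ) ≤ |(ν i : ℝ) - μ i|}
          ∂(P.run O μ n) := by
  have := hO.1
  have := P.isMarkovKernel_epoch O μ
  have hp := P.isProbabilityMeasure_run O μ
  have hc : 0 ≤ α * β * P.rStar μ := mul_nonneg (mul_nonneg hα0 hβ0) (P.rStar_nonneg μ)
  induction T with
  | zero => simp
  | succ T ih =>
    have hrun : ∫⁻ h, ENNReal.ofReal (∑ t, P.r μ (h.1 t)) ∂(P.run O μ (T + 1)) =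
        ∫⁻ h, ENNReal.ofReal (∑ t, P.r μ (h.1 t)) ∂(P.run O μ T) +
        ∫⁻ h, ∫⁻ y, ENNReal.ofReal (P.r μ y.1) ∂(P.epoch O μ h.2) ∂(P.run O μ T) := by
      rw [lintegral_run_succ, ← lintegral_add_left .of_discrete]
      refine lintegral_congr fun h => ?_
      simp only [Fin.sum_univ_castSucc, Fin.snoc_castSucc, Fin.snoc_last]
      simp only [ENNReal.ofReal_add (Finset.sum_nonneg fun t _ => P.r_nonneg μ (h.1 t))
        (P.r_nonneg μ _)]
      rw [lintegral_add_left measurable_const]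
      simp
    have hstep := lintegral_mono (μ := P.run O μ T)
      fun h => P.le_lintegral_epoch hf hα0 hα1 hβ1 hO hδ0 hδ h.2
    rw [lintegral_add_left .of_discrete, lintegral_const_mul _ .of_discrete, lintegral_const,
      measure_univ, mul_one] at hstep
    have hsplit : ((T + 1 : ℕ) : ℝ) * α * β * P.rStar μ =
        T * α * β * P.rStar μ + α * β * P.rStar μ := by push_cast; ring
    rw [hsplit, ENNReal.ofReal_add (by have := P.rStar_nonneg μ; positivity) hc, hrun,
      Finset.sum_range_succ, mul_add, add_add_add_comm]
    exact add_le_add ih hstep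

theorem regretCTS_le [Nonempty A] {f : ℝ≥0 → ℝ≥0} (hf : P.BoundedSmooth f)
    {μ : MeanVec m} (hind : P.OwnStateIndep μ) {pstar : ℝ} (hpstar : 0 < pstar)
    (htrig : ∀ S i, pstar ≤ P.trigProb μ S i)
    {α β : ℝ} (hα0 : 0 ≤ α) (hα1 : α ≤ 1) (hβ0 : 0 ≤ β) (hβ1 : β ≤ 1)
    {O : Kernel (MeanVec m) A} (hO : P.IsApproxOracle O α β) {δ : ℝ≥0} (hδ0 : 0 < δ)
    (hδ : (f δ : ℝ) = P.gapMin μ α / 2) (T : ℕ) :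
    P.regretCTS O μ α β T ≤
      P.gapMax μ α * (2 * m * (1 / (pstar * (1 - Real.exp (-(δ : ℝ) ^ 2))))) := by
  have := hO.1
  have := P.isProbabilityMeasure_run O μ T
  set q := 1 - pstar * (1 - Real.exp (-(δ : ℝ) ^ 2)) with hq
  have he : 0 < 1 - Real.exp (-(δ : ℝ) ^ 2) := by
    have : (0 : ℝ) < δ := hδ0
    exact sub_pos.2 (by rw [Real.exp_lt_one_iff]; nlinarith)
  have hq1 : 0 < 1 - q := by rw [hq, sub_sub_cancel]; positivity
  have hK : ∑ n ∈ Finset.range T,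
      ∫⁻ h, posterior m h.2 {ν : MeanVec m | ∃ i, (δ : ℝ) ≤ |(ν i : ℝ) - μ i|} ∂(P.run O μ n) ≤
      ENNReal.ofReal (2 * m * (1 / (pstar * (1 - Real.exp (-(δ : ℝ) ^ 2))))) := by
    refine (Finset.sum_le_sum fun n _ =>
      P.lintegral_posterior_run_le O hind htrig (NNReal.coe_pos.2 hδ0) n).trans ?_
    -- `pstar ≤ 1`, hence `0 ≤ q`, is read off the triggering probability of an arm, so `m = 0` is
    -- treated apart.
    rcases Nat.eq_zero_or_pos m with rfl | hm
    · simp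
    have hq0 : 0 ≤ q := by
      have hp1 : pstar ≤ 1 :=
        (htrig (Classical.arbitrary A) ⟨0, hm⟩).trans measureReal_le_one
      have := Real.exp_pos (-(δ : ℝ) ^ 2)
      rw [hq]
      nlinarith
    have hgeom : ∑ n ∈ Finset.range T, q ^ n ≤ 1 / (1 - q) := by
      rw [le_div_iff₀' hq1, mul_neg_geom_sum]
      exact sub_le_self _ (pow_nonneg hq0 T)
    calc _ = ENNReal.ofReal (2 * m * ∑ n ∈ Finset.range T, q ^ n) := by
          rw [← Finset.mul_sum, ENNReal.ofReal_mul (by positivity),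
            ENNReal.ofReal_mul (by positivity), ENNReal.ofReal_sum_of_nonneg
            fun n _ => pow_nonneg hq0 n]
          simp [← hq, ENNReal.ofReal_pow hq0]
      _ ≤ _ := by
          refine ENNReal.ofReal_le_ofReal ?_
          rw [hq, sub_sub_cancel] at hgeom
          gcongr
  have hint := P.integrable_sum_run O μ T
  have hnn (h : (Fin T → A) × Counters m) : 0 ≤ ∑ t, P.r μ (h.1 t) :=
    Finset.sum_nonneg fun t _ => P.r_nonneg μ _
  have hmain := (P.le_lintegral_run hf hα0 hα1 hβ0 hβ1 hO hδ0 hδ T).trans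
    (add_le_add_right (mul_le_mul_right hK _) _)
  have hg := P.gapMax_nonneg μ α
  rw [← ofReal_integral_eq_lintegral_ofReal hint (ae_of_all _ hnn), ← ENNReal.ofReal_mul hg,
    ← ENNReal.ofReal_add (integral_nonneg hnn) (by positivity),
    ENNReal.ofReal_le_ofReal_iff (add_nonneg (integral_nonneg hnn) (by positivity))] at hmain
  rw [regretCTS]
  linarith

theorem regretCTS_nonpos {μ : MeanVec m} {α β : ℝ} (hα0 : 0 ≤ α) (hβ1 : β ≤ 1)
    (O : Kernel (MeanVec m) A) [IsMarkovKernel O] (hbad : P.bad μ α = ∅) (T : ℕ) :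
    P.regretCTS O μ α β T ≤ 0 := by
  have := P.isProbabilityMeasure_run O μ T
  have hge (S : A) : α * β * P.rStar μ ≤ P.r μ S := by
    have h1 : S ∉ P.bad μ α := by simp [hbad]
    have h2 : α * P.rStar μ ≤ P.r μ S := not_lt.1 h1
    nlinarith [mul_nonneg hα0 (P.rStar_nonneg μ)]
  have hint := P.integrable_sum_run O μ T
  have h := integral_mono (μ := P.run O μ T) (integrable_const (∑ _t : Fin T, α * β * P.rStar μ))
    hint fun h => Finset.sum_le_sum fun t _ => hge (h.1 t)
  simp at h
  rw [regretCTS]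
  linarith

end Problem

/-! ### Comparison with the stated bound -/

theorem two_mul_div_one_sub_exp_le {m p d η : ℝ} (hm : 0 ≤ m) (hp : 0 < p) (hd : 0 < d)
    (hη0 : 0 < η) (hη1 : η < 1) :
    2 * m * (1 / (p * (1 - Real.exp (-d ^ 2)))) ≤
      (3 + Real.exp (2 * d)) * m * (1 + 2 / (d ^ 2 * η * p)) := by
  -- This is `exp (d²) ≥ 1 + d²`; the surplus factor `1 + d²` is then absorbed by `3 + exp (2d)`.
  have he : d ^ 2 / (1 + d ^ 2) ≤ 1 - Real.exp (-d ^ 2) := by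
    rw [Real.exp_neg]
    have h1 : (Real.exp (d ^ 2))⁻¹ ≤ (1 + d ^ 2)⁻¹ := by
      gcongr
      linarith [Real.add_one_le_exp (d ^ 2)]
    have h2 : d ^ 2 / (1 + d ^ 2) = 1 - (1 + d ^ 2)⁻¹ := by field_simp; ring
    linarith
  have h2 : 1 + d ^ 2 ≤ 3 + Real.exp (2 * d) := by
    nlinarith [Real.quadratic_le_exp_of_nonneg (x := 2 * d) (by positivity)]
  calc _ ≤ 2 * m * (1 / (p * (d ^ 2 / (1 + d ^ 2)))) := by gcongr
    _ = (1 + d ^ 2) * m * (2 / (d ^ 2 * 1 * p)) := by field_simp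
    _ ≤ (3 + Real.exp (2 * d)) * m * (2 / (d ^ 2 * η * p)) := by gcongr
    _ ≤ _ := by
        gcongr
        linarith

end CMAB

theorem theorem6 {m : ℕ} {A : Type*} [Fintype A] [Nonempty A] [MeasurableSpace A]
    [DiscreteMeasurableSpace A] (P : CMAB.Problem m A)
    (f : ℝ≥0 → ℝ≥0) (hf : P.BoundedSmooth f) (hmono : P.MonotoneReward)
    (μ : CMAB.MeanVec m)
    (hind : P.OwnStateIndep μ)
    (pstar : ℝ) (hpstar : 0 < pstar) (htrig : ∀ S i, pstar ≤ P.trigProb μ S i)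
    (α β : ℝ) (hα0 : 0 ≤ α) (hα1 : α ≤ 1) (hβ0 : 0 ≤ β) (hβ1 : β ≤ 1)
    (O : Kernel (CMAB.MeanVec m) A) (hO : P.IsApproxOracle O α β)
    (δ : ℝ≥0) (hδ : (f δ : ℝ) = P.gapMin μ α / 2)
    (T : ℕ) (hT : 1 ≤ T) :
    P.regretCTS O μ α β T ≤
      P.gapMax μ α * ⨅ η : Set.Ioo (0 : ℝ) 1,
        ((⌈4 * (1 / (pstar * (1 - (η : ℝ))) ^ 2) ^ 2 / Real.exp 1 ^ 2⌉₊ : ℝ)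
          + (3 + Real.exp (2 * δ)) * m * Real.pi ^ 2 / 6 * (1 + 2 / (δ : ℝ) ^ 2)
          + (3 + Real.exp (2 * δ)) * m * (1 + 2 / ((δ : ℝ) ^ 2 * (η : ℝ) * pstar))) := by
  have := hO.1
  have hg := P.gapMax_nonneg μ α
  rcases (P.bad μ α).eq_empty_or_nonempty with hbad | hbad
  -- The supremum over the empty set is `0`, so here the regret must be nonpositive.
  · have h0 : P.gapMax μ α = 0 := by simp [CMAB.Problem.gapMax, hbad]
    rw [h0, zero_mul]
    exact P.regretCTS_nonpos hα0 hβ1 O hbad T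
  -- With a bad action present `gapMin > 0`, whereas `f 0 = 0`.
  have hδ0 : 0 < δ := by
    rw [pos_iff_ne_zero]
    rintro rfl
    rw [hf.zero, NNReal.coe_zero] at hδ
    linarith [P.gapMin_pos hbad]
  refine (P.regretCTS_le hf hind hpstar htrig hα0 hα1 hβ0 hβ1 hO hδ0 hδ T).trans
    (mul_le_mul_of_nonneg_left ?_ hg)
  have : Nonempty (Set.Ioo (0 : ℝ) 1) := ⟨⟨1 / 2, by norm_num, by norm_num⟩⟩
  refine le_ciInf fun η => ?_
  -- The last summand alone suffices; the other two are nonnegative.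
  refine (CMAB.two_mul_div_one_sub_exp_le m.cast_nonneg hpstar (NNReal.coe_pos.2 hδ0)
    η.2.1 η.2.2).trans (le_add_of_nonneg_left ?_)
  positivity
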